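/- **Conventions.** Let $C\subseteq F^n$ be a linear code over a finite field $F$; it has parameters $[n,k,d]$ if $\dim_F C=k$ and its minimum Hamming distance is $d$. For $R\subseteq\{1,\dots,n\}$, let $C[R]$ be the projection of $C$ on the coordinates in $R$. $C$ is an $(r,\delta)$-LRC if every coordinate $i$ lies in some $R\subseteq\{1,\dots,n\}$ with $\#R\le r+\delta-1$ such that $C[R]$ has minimum distance at least $\delta$. It is an *optimal* $(r,\delta)$-LRC if moreover $$k+d+\left(\left\lceil \tfrac{k}{r}\right\rceil-1\right)(\delta-1)=n+1 .$$ Let $\mathbb F_q$ be a finite field, $n_1,n_2$ positive integers and $J\subseteq\{1,2\}$, with $n_j\mid q-1$ for $j\in J$, and $n_j\geq 2$, $n_j-1\mid q-1$ for $j\notin J$. Let $P_j\subseteq\mathbb F_q$ be the set of zeros of $X^{n_j}-1$ if $j\in J$ and of $X^{n_j}-X$ if $j\notin J$, and let $P=P_1\times P_2=\{\alpha_1,\dots,\alpha_n\}$. For a nonempty set $\Delta\subseteq\{0,\dots,n_1-1\}\times\{0,\dots,n_2-1\}$, the span over $\mathbb F_q$ of the vectors $(X^{e}(\alpha_1),\dots,X^{e}(\alpha_n))$,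 where $e\in\Delta$ and $X^{(e_1,e_2)}=X_1^{e_1}X_2^{e_2}$, is a *bivariate $J$-affine variety code* on $(n_1,n_2)$. The *subfield-subcode* over a subfield $F\subseteq\mathbb F_q$ of a code $C\subseteq\mathbb F_q^n$ is $C\cap F^n$. **Theorem.** Let $p$ be a prime, $l,h$ positive integers with $h\mid l$, $q=p^l$, $p^h\ge 4$ if $p=2$ and $p^h\ge 5$ if $p$ is odd, and assume $p^h+1\mid q-1$. Regard $\mathbb F_{p^h}$ as a subfield of $\mathbb F_q$. (A) Let $z,t$ be integers with $0\le t<z\le\lfloor p^h/2\rfloor-1$ and $2t\ge\max\{0,4z-p^h-1\}$. Let $n'\geq 1$ and $a$ be integers such that one of the following holds: 1. $n'\mid q-1$ and $a=z$; 2. $n'-1\mid q-1$ and $a=z$; 3. $n'-1\mid q-1$, $a=t$ and, if $p$ is odd, $\gcd(n',p^h)\ne1$ or $\gcd(n',p^h+1)\neq 1$. Then there is a linear code over $\mathbb F_{p^h}$ with parameters $$\left[(p^h+1)n',\ (n'-1)(2z+1)+2a+1,\ p^h+1-2a\right]$$ which is an optimal $(r,\delta)$-LRC for $(r,\delta)=(2z+1,\,p^h-2z+1)$,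 and which is the subfield-subcode over $\mathbb F_{p^h}$ of a bivariate $J$-affine variety code over $\mathbb F_q$ on $(p^h+1,n')$ for some $J$. (B) Assume $p=2$ and let $u$ be an integer with $0\le u\le \frac{p^h}{2}-2$. Let $n'\geq 1$ and $a$ be integers such that one of the following holds: 1. $n'\mid q-1$ and $a=u$; 2. $n'-1\mid q-1$ and $a=u$; 3. $n'-1\mid q-1$ and $a=v$ for some integer $v$ with $0\le v<u$ and $2v+1\ge\max\{0,4u+1-p^h\}$. Then there is a linear code over $\mathbb F_{p^h}$ with parameters $$\left[(p^h+1)n',\ (n'-1)(2u+2)+2a+2,\ p^h-2a\right]$$ which is an optimal $(r,\delta)$-LRC for $(r,\delta)=(2u+2,\,p^h-2u)$, and which is the subfield-subcode over $\mathbb F_{p^h}$ of a bivariate $J$-affine variety code over $\mathbb F_q$ on $(p^h+1,n')$ for some $J$. -/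

import Mathlib

namespace LRC

/-- The minimum distance of a linear code, as an element of `ℕ∞`
(it is `⊤` exactly for the zero code). -/
noncomputable def minDist {F ι : Type*} [Field F] [Fintype ι] (C : Submodule F (ι → F)) : ℕ∞ :=
  open Classical in ⨅ (x ∈ C) (y ∈ C) (_ : x ≠ y), (hammingDist x y : ℕ∞)

/-- The projection `C[R]` of a code of length `n` on the coordinates in `R`. -/
def proj {F : Type*} [Field F] {n : ℕ} (C : Submodule F (Fin n → F)) (R : Finset (Fin n)) :
    Submodule F (R → F) :=
  C.map (LinearMap.funLeft F F (Subtype.val : R → Fin n))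

/-- `C` is a linear code with parameters `[n, k, d]`. -/
def HasParameters {F : Type*} [Field F] {n : ℕ} (C : Submodule F (Fin n → F)) (k d : ℕ) : Prop :=
  Module.finrank F C = k ∧ minDist C = d

/-- `C` is locally recoverable with locality `(r, δ)`: every coordinate `i` lies in a set `R` of
at most `r + δ - 1` coordinates such that `C[R]` has minimum distance at least `δ`. -/
def IsLRC {F : Type*} [Field F] {n : ℕ} (C : Submodule F (Fin n → F)) (r δ : ℕ) : Prop :=
  ∀ i : Fin n, ∃ R : Finset (Fin n), i ∈ R ∧ R.card + 1 ≤ r + δ ∧ (δ : ℕ∞) ≤ minDist (proj C R)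

/-- `C` is an optimal `(r, δ)`-LRC: it has locality `(r, δ)` and its parameters `[n, k, d]` attain
the Singleton-like bound `k + d + (⌈k / r⌉ - 1) (δ - 1) ≤ n + 1`. -/
def IsOptimalLRC {F : Type*} [Field F] {n : ℕ} (C : Submodule F (Fin n → F)) (r δ : ℕ) : Prop :=
  IsLRC C r δ ∧ ∃ k d : ℕ, HasParameters C k d ∧
    (k : ℤ) + d + (⌈(k : ℚ) / (r : ℚ)⌉ - 1) * ((δ : ℤ) - 1) = n + 1

/-- The set `P = P₁ × ⋯ × Pₘ`, where `P_j` is the zero set of `X ^ n_j - 1` for `j ∈ J` and of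
`X ^ n_j - X` for `j ∉ J`. -/
def jAffinePoints (K : Type*) [Field K] {m : ℕ} (n : Fin m → ℕ) (J : Finset (Fin m)) :
    Set (Fin m → K) :=
  {x | ∀ j, (j ∈ J → x j ^ n j = 1) ∧ (j ∉ J → x j ^ n j = x j)}

/-- The code spanned by the evaluations of the monomials `X ^ e`, `e ∈ Δ`, at the points
`α 0, …, α (N - 1)`; a monomial-Cartesian code when `α` enumerates a Cartesian product. -/
def monomialCode {K : Type*} [Field K] {m N : ℕ} (α : Fin N → Fin m → K)
    (Δ : Set (Fin m → ℕ)) : Submodule K (Fin N → K) :=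
  Submodule.span K ((fun (e : Fin m → ℕ) (i : Fin N) => ∏ j, α i j ^ e j) '' Δ)

/-- The subfield-subcode `C ∩ Fᴺ` of a code `C ⊆ Kᴺ`. -/
def subfieldSubcode (F : Type*) {K : Type*} [Field F] [Field K] [Algebra F K] {N : ℕ}
    (C : Submodule K (Fin N → K)) : Submodule F (Fin N → F) :=
  (C.restrictScalars F).comap ((Algebra.linearMap F K).compLeft (Fin N))

/-- `C` is the subfield-subcode over `F` of some `J`-affine variety code over `K` in `m` variables
with `n_j` points in the `j`-th variable, given by a nonempty set `Δ` of exponents contained in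
`{0, …, n₁ - 1} × ⋯ × {0, …, nₘ - 1}`. -/
def IsSubfieldSubcodeOfJAffine (K : Type*) {F : Type*} [Field F] [Field K] [Fintype K]
    [Algebra F K] {m N : ℕ} (n : Fin m → ℕ) (C : Submodule F (Fin N → F)) : Prop :=
  ∃ (J : Finset (Fin m)) (Δ : Set (Fin m → ℕ)) (α : Fin N ≃ jAffinePoints K n J),
    (∀ j ∈ J, n j ∣ Fintype.card K - 1) ∧
    (∀ j ∉ J, n j - 1 ∣ Fintype.card K - 1) ∧
    Δ.Nonempty ∧ (∀ e ∈ Δ, ∀ j, e j < n j) ∧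
    C = subfieldSubcode F (monomialCode (fun i => (α i : Fin m → K)) Δ)

end LRC

namespace LRC

open Finset Polynomial

section MinDist

variable {F ι : Type*} [Field F] [Fintype ι]

open Classical in
theorem le_minDist {C : Submodule F (ι → F)} {d : ℕ}
    (h : ∀ x ∈ C, x ≠ 0 → d ≤ #{i | x i ≠ 0}) : (d : ℕ∞) ≤ minDist C := by
  refine le_iInf₂ fun x hx => le_iInf₂ fun y hy => le_iInf fun hxy => ?_
  rw [hammingDist_comm, hammingDist_eq_hammingNorm, Nat.cast_le, neg_add_eq_sub]
  exact h (x - y) (C.sub_mem hx hy) (sub_ne_zero.mpr hxy)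

open Classical in
theorem minDist_le {C : Submodule F (ι → F)} {x : ι → F} (hx : x ∈ C) (hx0 : x ≠ 0) :
    minDist C ≤ (#{i | x i ≠ 0} : ℕ) := by
  refine (iInf₂_le x hx).trans ((iInf₂_le 0 C.zero_mem).trans ((iInf_le _ hx0).trans ?_))
  rw [hammingDist_zero_right]
  exact le_of_eq rfl

theorem exists_ne_zero_vanishing_on [DecidableEq ι] {C : Submodule F (ι → F)} (T : Finset ι)
    (hT : #T < Module.finrank F C) : ∃ x ∈ C, x ≠ 0 ∧ ∀ i ∈ T, x i = 0 := by
  let f : C →ₗ[F] (T → F) := (LinearMap.funLeft F F (Subtype.val : T → ι)).comp C.subtype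
  have hf : LinearMap.ker f ≠ ⊥ := LinearMap.ker_ne_bot_of_finrank_lt (by simpa using hT)
  obtain ⟨x, hx, hx0⟩ := (Submodule.ne_bot_iff _).mp hf
  refine ⟨x, x.2, by simpa using hx0, fun i hi => ?_⟩
  exact congrFun (LinearMap.mem_ker.mp hx) ⟨i, hi⟩

end MinDist

section Descent

variable {F K : Type*} [Field F] [Field K] [Algebra F K]

theorem finrank_subfieldSubcode_le [FiniteDimensional F K] {N : ℕ} (V : Submodule K (Fin N → K)) :
    Module.finrank F (subfieldSubcode F V) ≤ Module.finrank K V := by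
  let b := Module.finBasis F K
  let W := subfieldSubcode F V
  let f : (Fin (Module.finrank F K) → W) →ₗ[F] V.restrictScalars F :=
    { toFun := fun w => ⟨∑ j, b j • (Algebra.linearMap F K).compLeft (Fin N) (w j : Fin N → F),
        V.sum_mem fun j _ => V.smul_mem _ (w j).2⟩
      map_add' := fun w w' => by
        ext1
        simp [sum_add_distrib]
      map_smul' := fun a w => by
        ext1
        simp [smul_sum, smul_comm a] }
  have hf : Function.Injective f := by
    rw [injective_iff_map_eq_zero]
    intro w hw
    ext j i
    have hi : ∑ j, (w j : Fin N → F) i • b j = 0 := by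
      have := congrFun (congrArg Subtype.val hw) i
      simpa [f, Algebra.smul_def, mul_comm] using this
    exact Fintype.linearIndependent_iff.mp b.linearIndependent _ hi j
  have h1 := LinearMap.finrank_le_finrank_of_injective hf
  have h2 : Module.finrank F (V.restrictScalars F) = Module.finrank F K * Module.finrank K V :=
    (Module.finrank_mul_finrank F K V).symm
  rw [h2, Module.finrank_pi_fintype, sum_const, card_univ, Fintype.card_fin, smul_eq_mul] at h1
  exact Nat.le_of_mul_le_mul_left h1 Module.finrank_pos

theorem mem_range_algebraMap_of_pow_card_eq [Fintype F] {y : K} (hy : y ^ Fintype.card F = y) :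
    ∃ a : F, algebraMap F K a = y := by
  classical
  by_contra! hne
  have h0 : (X ^ Fintype.card F - X : K[X]) ≠ 0 :=
    FiniteField.X_pow_card_sub_X_ne_zero K Fintype.one_lt_card
  have := card_le_degree_of_subset_roots (p := (X ^ Fintype.card F - X : K[X]))
    (Z := insert y (univ.image (algebraMap F K))) (by
      intro x hx
      rw [mem_roots h0]
      have hx : x = y ∨ ∃ a, algebraMap F K a = x := by simpa using hx
      rcases hx with rfl | ⟨a, rfl⟩
      · simp [hy]
      · simp [← map_pow, FiniteField.pow_card])
  rw [FiniteField.X_pow_card_sub_X_natDegree_eq K Fintype.one_lt_card,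
    card_insert_of_notMem (by simpa using hne),
    card_image_of_injective _ (algebraMap F K).injective, card_univ] at this
  omega

/-- Galois descent: if `Kᴺ = V ⊕ V'` with both summands stable under the coordinatewise Frobenius
of `F`, then the subfield-subcode of `V` has the dimension of `V`. -/
theorem finrank_subfieldSubcode [Fintype F] [FiniteDimensional F K] {N : ℕ}
    {V V' : Submodule K (Fin N → K)} (h : IsCompl V V')
    (hV : ∀ v ∈ V, (fun i => v i ^ Fintype.card F) ∈ V)
    (hV' : ∀ v ∈ V', (fun i => v i ^ Fintype.card F) ∈ V') :
    Module.finrank F (subfieldSubcode F V) = Module.finrank K V := by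
  have hsup : subfieldSubcode F V ⊔ subfieldSubcode F V' = ⊤ := by
    rw [eq_top_iff]
    intro f _
    have hf : (fun i => algebraMap F K (f i)) ∈ V ⊔ V' := h.sup_eq_top ▸ Submodule.mem_top
    obtain ⟨v, hv, v', hv', hsum⟩ := Submodule.mem_sup.mp hf
    have hs : ∀ i, v i + v' i = algebraMap F K (f i) := fun i => congrFun hsum i
    have hfrob : ∀ i, v i ^ Fintype.card F + v' i ^ Fintype.card F = v i + v' i := fun i => by
      have := map_add (FiniteField.frobeniusAlgHom F K) (v i) (v' i)
      simp only [FiniteField.coe_frobeniusAlgHom] at this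
      rw [← this, hs, ← map_pow, FiniteField.pow_card]
    have hd : (fun i => v i ^ Fintype.card F) - v = v' - fun i => v' i ^ Fintype.card F := by
      ext i
      simp only [Pi.sub_apply]
      linear_combination hfrob i
    have hz : (fun i => v i ^ Fintype.card F) - v = 0 :=
      Submodule.disjoint_def.mp h.disjoint _ (V.sub_mem (hV v hv) hv)
        (hd ▸ V'.sub_mem hv' (hV' v' hv'))
    choose a ha using fun i => mem_range_algebraMap_of_pow_card_eq (F := F)
      (sub_eq_zero.mp (congrFun hz i) : v i ^ Fintype.card F = v i)
    have hva : (fun i => algebraMap F K (a i)) = v := funext ha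
    refine Submodule.mem_sup.mpr ⟨a, ?_, f - a, ?_, by abel⟩
    · change (fun i => algebraMap F K (a i)) ∈ V
      rwa [hva]
    · change (fun i => algebraMap F K (f i - a i)) ∈ V'
      convert hv' using 1
      ext i
      rw [map_sub, ha, ← hs]; ring
  have h1 := Submodule.finrank_add_le_finrank_add_finrank
    (subfieldSubcode F V) (subfieldSubcode F V')
  rw [hsup, finrank_top, Module.finrank_fin_fun] at h1
  have h2 := Submodule.finrank_add_eq_of_isCompl h
  rw [Module.finrank_fin_fun] at h2
  have h3 := finrank_subfieldSubcode_le (F := F) V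
  have h4 := finrank_subfieldSubcode_le (F := F) V'
  omega

end Descent

section Polynomial

variable {K : Type*} [Field K]

/-- A nontrivial combination of monomials of degree `< s` has fewer than `s` zeros. -/
theorem sum_monomial_eq_zero {ι : Type*} {E : Finset ι} {d : ι → ℕ} {s : ℕ}
    (hE : ∀ e ∈ E, d e < s) (c : ι → K) {S : Finset K} (hS : s ≤ #S)
    (h : ∀ x ∈ S, ∑ e ∈ E, c e * x ^ d e = 0) : ∑ e ∈ E, C (c e) * X ^ d e = 0 := by
  rcases E.eq_empty_or_nonempty with rfl | ⟨e₀, he₀⟩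
  · simp
  refine eq_zero_of_natDegree_lt_card_of_eval_eq_zero' _ S (fun x hx => ?_)
    (lt_of_lt_of_le (b := s) ?_ hS)
  · simpa [eval_finsetSum] using h x hx
  · have := hE e₀ he₀
    have := natDegree_sum_le_of_forall_le (n := s - 1) E (fun e => C (c e) * X ^ d e)
      fun e he => (natDegree_C_mul_X_pow_le _ _).trans (by have := hE e he; omega)
    omega

theorem coeff_eq_zero_of_sum_pow_eq_zero {n : ℕ} (c : ℕ → K) {S : Finset K} (hS : n ≤ #S)
    (h : ∀ x ∈ S, ∑ j ∈ range n, c j * x ^ j = 0) {j : ℕ} (hj : j < n) : c j = 0 := by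
  have := sum_monomial_eq_zero (d := id) (fun e he => mem_range.mp he) c hS h
  have := congrArg (coeff · j) this
  simpa [finsetSum_coeff, coeff_X_pow, hj] using this

/-- Cyclically consecutive exponents give an MDS code on the `M`-th roots of unity. -/
theorem sum_pow_eq_zero_of_cyclic {M m s : ℕ} {X : Finset K} (hM : 0 < M)
    (hX : ∀ x ∈ X, x ^ M = 1) {E : Finset ℕ} (hE : ∀ e ∈ E, (e + m) % M < s) (c : ℕ → K)
    {S : Finset K} (hSX : S ⊆ X) (hS : s ≤ #S)
    (h : ∀ x ∈ S, ∑ e ∈ E, c e * x ^ e = 0) {x : K} (hx : x ∈ X) :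
    ∑ e ∈ E, c e * x ^ e = 0 := by
  have key : ∀ x ∈ X, ∑ e ∈ E, c e * x ^ ((e + m) % M) = x ^ m * ∑ e ∈ E, c e * x ^ e := by
    intro x hx
    rw [mul_sum]
    refine sum_congr rfl fun e _ => ?_
    rw [← pow_eq_pow_mod _ (hX x hx)]
    ring
  have hp := sum_monomial_eq_zero hE c hS fun x hx => by rw [key x (hSX hx), h x hx, mul_zero]
  have hx0 : x ≠ 0 := by
    rintro rfl
    simpa [hM.ne'] using hX 0 hx
  have := congrArg (eval x) hp
  simp only [eval_finsetSum, eval_mul, eval_C, eval_pow, eval_X, eval_zero] at this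
  rw [key x hx] at this
  exact (mul_eq_zero.mp this).resolve_left (pow_ne_zero _ hx0)

end Polynomial

end LRC

namespace LRC

open Finset

variable {K : Type*} [Field K]

/-- The evaluation vector of the monomial `X₁ ^ e.1 * X₂ ^ e.2` at the points of `X × Y`. -/
def evalMonomial {N : ℕ} {X Y : Finset K} (β : Fin N ≃ X × Y) (e : ℕ × ℕ) : Fin N → K :=
  fun i => ((β i).1 : K) ^ e.1 * ((β i).2 : K) ^ e.2

/-- The exponents `(e, j)` with `j < n'`, and with `e ∈ E'` when `j` is the largest possible and
`e ∈ E` otherwise. -/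
def exponentSet (E E' : Finset ℕ) (n' : ℕ) : Finset (ℕ × ℕ) :=
  (E ×ˢ range n').filter fun e => e.2 + 1 = n' → e.1 ∈ E'

theorem card_exponentSet {E E' : Finset ℕ} (hE : E' ⊆ E) {n' : ℕ} (hn : 0 < n') :
    #(exponentSet E E' n') = (n' - 1) * #E + #E' := by
  obtain ⟨n, rfl⟩ := Nat.exists_eq_succ_of_ne_zero hn.ne'
  have : exponentSet E E' (n + 1) = (E ×ˢ range n) ∪ (E' ×ˢ {n}) := by
    ext ⟨e, j⟩
    simp only [exponentSet, mem_filter, mem_product, mem_range, mem_union, mem_singleton]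
    constructor
    · rintro ⟨⟨h1, h2⟩, h3⟩
      by_cases hj : j = n
      · exact .inr ⟨h3 (by omega), hj⟩
      · exact .inl ⟨h1, by omega⟩
    · rintro (⟨h1, h2⟩ | ⟨h1, h2⟩)
      · exact ⟨⟨h1, by omega⟩, fun h => by omega⟩
      · exact ⟨⟨hE h1, by omega⟩, fun _ => h1⟩
  rw [Nat.succ_eq_add_one, this, card_union_of_disjoint, card_product, card_product, card_range,
    card_singleton, mul_one, Nat.add_sub_cancel, mul_comm]
  rw [disjoint_left]
  rintro ⟨e, j⟩ h1 h2
  simp only [mem_product, mem_range, mem_singleton] at h1 h2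
  omega

section Independence

variable {N M n' : ℕ} {X Y : Finset K}

theorem linearIndepOn_evalMonomial (β : Fin N ≃ X × Y) (hX : #X = M) (hY : #Y = n') :
    LinearIndepOn K (evalMonomial β) (range M ×ˢ range n' : Finset (ℕ × ℕ)) := by
  rw [linearIndepOn_finset_iff]
  intro c hc e he
  rw [mem_product, mem_range, mem_range] at he
  have h : ∀ x ∈ X, ∀ y ∈ Y, ∑ j ∈ range n', (∑ a ∈ range M, c (a, j) * x ^ a) * y ^ j = 0 := by
    intro x hx y hy
    have := congrFun hc (β.symm (⟨x, hx⟩, ⟨y, hy⟩))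
    simp only [evalMonomial, Finset.sum_apply, Pi.smul_apply, Equiv.apply_symm_apply, smul_eq_mul,
      Pi.zero_apply, sum_product_right] at this
    rw [← this]
    refine sum_congr rfl fun j _ => ?_
    rw [sum_mul]
    exact sum_congr rfl fun a _ => by ring
  exact coeff_eq_zero_of_sum_pow_eq_zero (fun a => c (a, e.2)) hX.ge (fun x hx =>
    coeff_eq_zero_of_sum_pow_eq_zero (fun j => ∑ a ∈ range M, c (a, j) * x ^ a) hY.ge (h x hx)
      he.2) he.1

theorem finrank_span_evalMonomial (β : Fin N ≃ X × Y) (hX : #X = M) (hY : #Y = n')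
    {D : Finset (ℕ × ℕ)} (hD : D ⊆ range M ×ˢ range n') :
    Module.finrank K (Submodule.span K (evalMonomial β '' D)) = #D := by
  have hli := (linearIndepOn_evalMonomial β hX hY).mono (coe_subset.mpr hD)
  have := finrank_span_eq_card hli
  rw [Set.image_eq_range]
  simpa using this

theorem isCompl_span_evalMonomial (β : Fin N ≃ X × Y) (hX : #X = M) (hY : #Y = n')
    {D : Finset (ℕ × ℕ)} (hD : D ⊆ range M ×ˢ range n') :
    IsCompl (Submodule.span K (evalMonomial β '' D))
      (Submodule.span K (evalMonomial β '' ((range M ×ˢ range n') \ D : Finset (ℕ × ℕ)))) := by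
  have hN : N = M * n' := by
    have := Fintype.card_congr β
    simpa [hX, hY] using this
  have hunion : (D : Set (ℕ × ℕ)) ∪ ((range M ×ˢ range n') \ D : Finset (ℕ × ℕ)) =
      (range M ×ˢ range n' : Finset (ℕ × ℕ)) := by
    rw [← coe_union, union_sdiff_of_subset hD]
  constructor
  · have hli := linearIndepOn_evalMonomial β hX hY
    rw [← hunion, linearIndepOn_union_iff (by exact_mod_cast disjoint_sdiff)] at hli
    exact hli.2.2
  · rw [codisjoint_iff, ← Submodule.span_union, ← Set.image_union, hunion]
    apply Submodule.eq_top_of_finrank_eq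
    rw [finrank_span_evalMonomial β hX hY subset_rfl, Module.finrank_fin_fun, card_product,
      card_range, card_range, hN]

end Independence

/-- A polynomial supported on `exponentSet E E' n'`, expanded in powers of the second variable. -/
theorem sum_exponentSet_eq {E E' : Finset ℕ} {n' : ℕ} (c : ℕ × ℕ → K) (x y : K) :
    ∑ e ∈ exponentSet E E' n', c e * (x ^ e.1 * y ^ e.2) =
      ∑ j ∈ range n',
        (∑ a ∈ E, (if j + 1 = n' → a ∈ E' then c (a, j) else 0) * x ^ a) * y ^ j := by
  rw [exponentSet, sum_filter, sum_product_right]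
  refine sum_congr rfl fun j _ => ?_
  rw [sum_mul]
  refine sum_congr rfl fun a _ => ?_
  split_ifs <;> ring

theorem sum_exponentSet_eq_sum_fst {E E' : Finset ℕ} {n' : ℕ} (c : ℕ × ℕ → K) (y : K) :
    ∃ g : ℕ → K, ∀ x, ∑ e ∈ exponentSet E E' n', c e * (x ^ e.1 * y ^ e.2) =
      ∑ a ∈ E, g a * x ^ a := by
  refine ⟨fun a => ∑ j ∈ range n', (if j + 1 = n' → a ∈ E' then c (a, j) else 0) * y ^ j,
    fun x => ?_⟩
  rw [sum_exponentSet_eq]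
  simp only [sum_mul]
  rw [sum_comm]
  exact sum_congr rfl fun a _ => sum_congr rfl fun j _ => by ring

theorem sum_exponentSet_eq_zero_of_fiber {M m s n' : ℕ} {X : Finset K} (hM : 0 < M)
    (hX : ∀ x ∈ X, x ^ M = 1) {E E' : Finset ℕ} (hE : ∀ e ∈ E, (e + m) % M < s)
    (c : ℕ × ℕ → K) (y : K) {S : Finset K} (hSX : S ⊆ X) (hS : s ≤ #S)
    (h : ∀ x ∈ S, ∑ e ∈ exponentSet E E' n', c e * (x ^ e.1 * y ^ e.2) = 0)
    {x : K} (hx : x ∈ X) : ∑ e ∈ exponentSet E E' n', c e * (x ^ e.1 * y ^ e.2) = 0 := by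
  obtain ⟨g, hg⟩ := sum_exponentSet_eq_sum_fst (E := E) (E' := E') (n' := n') c y
  rw [hg]
  exact sum_pow_eq_zero_of_cyclic hM hX hE g hSX hS (fun x hx => by rw [← hg, h x hx]) hx

/-- A word vanishing on all fibres but one has at least `#X + 1 - s'` nonzero entries in the
remaining one, because its restriction is proportional to the coefficient of the largest power
of the second variable. -/
theorem sum_exponentSet_eq_zero_of_single_fiber {M m' s' n' : ℕ} {X Y : Finset K} (hM : 0 < M)
    (hX : ∀ x ∈ X, x ^ M = 1) (hY : #Y = n') {E E' : Finset ℕ} (hEE : E' ⊆ E)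
    (hE' : ∀ e ∈ E', (e + m') % M < s') (c : ℕ × ℕ → K) {y₀ : K} (hy₀ : y₀ ∈ Y)
    (h0 : ∀ x ∈ X, ∀ y ∈ Y, y ≠ y₀ →
      ∑ e ∈ exponentSet E E' n', c e * (x ^ e.1 * y ^ e.2) = 0)
    {S : Finset K} (hSX : S ⊆ X) (hS : s' ≤ #S)
    (h : ∀ x ∈ S, ∑ e ∈ exponentSet E E' n', c e * (x ^ e.1 * y₀ ^ e.2) = 0)
    {x : K} (hx : x ∈ X) : ∑ e ∈ exponentSet E E' n', c e * (x ^ e.1 * y₀ ^ e.2) = 0 := by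
  classical
  obtain ⟨n, rfl⟩ : ∃ n, n' = n + 1 :=
    Nat.exists_eq_succ_of_ne_zero (hY ▸ (card_pos.mpr ⟨y₀, hy₀⟩).ne')
  let G : K → ℕ → K := fun x j =>
    ∑ a ∈ E, (if j + 1 = n + 1 → a ∈ E' then c (a, j) else 0) * x ^ a
  have hG : ∀ x y, ∑ e ∈ exponentSet E E' (n + 1), c e * (x ^ e.1 * y ^ e.2) =
      ∑ j ∈ range (n + 1), G x j * y ^ j := fun x y => sum_exponentSet_eq c x y
  have htop : ∀ x, G x n = ∑ a ∈ E', c (a, n) * x ^ a := fun x => by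
    simp only [G, forall_const, ite_mul, zero_mul]
    rw [← sum_filter, filter_mem_eq_inter, inter_eq_right.mpr hEE]
  have hSG : ∀ x ∈ S, G x n = 0 := fun x hx =>
    coeff_eq_zero_of_sum_pow_eq_zero (G x) hY.ge (fun y hy => by
      rw [← hG]
      by_cases hyy : y = y₀
      · rw [hyy]; exact h x hx
      · exact h0 x (hSX hx) y hy hyy) n.lt_succ_self
  have hGx : G x n = 0 := by
    rw [htop]
    exact sum_pow_eq_zero_of_cyclic hM hX hE' _ hSX hS (fun x hx => by rw [← htop, hSG x hx]) hx
  have hlow : ∀ j < n, G x j = 0 := fun j hj =>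
    coeff_eq_zero_of_sum_pow_eq_zero (S := Y.erase y₀) (G x)
      (by rw [card_erase_of_mem hy₀, hY]; omega) (fun y hy => by
        have := h0 x hx y (mem_of_mem_erase hy) (ne_of_mem_erase hy)
        rwa [hG, sum_range_succ, hGx, zero_mul, add_zero] at this) hj
  rw [hG]
  refine sum_eq_zero fun j hj => ?_
  rcases (Nat.lt_succ_iff_lt_or_eq.mp (mem_range.mp hj)) with hj | rfl
  · rw [hlow j hj, zero_mul]
  · rw [hGx, zero_mul]

end LRC

namespace LRC

open Finset

section Fibers

variable {K : Type*} {N : ℕ} {X Y : Finset K}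

open Classical in
/-- If a word vanishes on a fibre as soon as it vanishes at `t` of its points, then its weight on
that fibre is either `0` or at least `#X + 1 - t`. -/
theorem card_fiber_support {L : Type*} [Zero L] (β : Fin N ≃ X × Y) {v : Fin N → L} {w : K → K → L}
    (hv : ∀ i, v i = w (β i).1 (β i).2) {t : ℕ} {i₀ : Fin N} (hi₀ : v i₀ ≠ 0)
    (h : ∀ S ⊆ X, t ≤ #S → (∀ x ∈ S, w x (β i₀).2 = 0) → ∀ x ∈ X, w x (β i₀).2 = 0) :
    #X + 1 ≤ #{i | v i ≠ 0 ∧ (β i).2 = (β i₀).2} + t := by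
  have h1 : #{x ∈ X | w x (β i₀).2 = 0} < t := by
    by_contra! hc
    refine hi₀ ?_
    rw [hv]
    exact h _ (filter_subset _ _) hc (fun x hx => (mem_filter.mp hx).2) _ (β i₀).1.2
  have h2 : #{x ∈ X | ¬ w x (β i₀).2 = 0} ≤ #{i | v i ≠ 0 ∧ (β i).2 = (β i₀).2} := by
    refine (card_le_card ?_).trans (card_image_le (f := fun i => ((β i).1 : K)))
    intro x hx
    rw [mem_filter] at hx
    refine mem_image.mpr ⟨β.symm (⟨x, hx.1⟩, (β i₀).2), ?_, by simp⟩
    simpa [hv] using hx.2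
  have h3 := card_filter_add_card_filter_not (s := X) (fun x => w x (β i₀).2 = 0)
  omega

open Classical in
/-- A Singleton-type argument: imposing `s` zeros on all fibres but one and `s' - 1` zeros on the
last one leaves a nonzero word of weight at most `M + 1 - s'`. -/
theorem exists_weight_le {F : Type*} [Field F] {M n' s s' : ℕ} (β : Fin N ≃ X × Y)
    (hXM : #X = M) (hY : #Y = n') (hn : 0 < n') {C : Submodule F (Fin N → F)}
    (hfib : ∀ f ∈ C, ∀ y : Y, ∀ S : Finset X, s ≤ #S → (∀ x ∈ S, f (β.symm (x, y)) = 0) →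
      ∀ x, f (β.symm (x, y)) = 0)
    (hs' : 0 < s') (hs'M : s' ≤ M) (hsM : s ≤ M)
    (hC : Module.finrank F C = (n' - 1) * s + s') :
    ∃ f ∈ C, f ≠ 0 ∧ #{i | f i ≠ 0} + s' ≤ M + 1 := by
  have hXc : #(univ : Finset X) = M := by simpa using hXM
  have hYc : #(univ : Finset Y) = n' := by simpa using hY
  obtain ⟨X₁, -, hX₁⟩ := exists_subset_card_eq (s := (univ : Finset X)) (n := s' - 1) (by omega)
  obtain ⟨X₂, -, hX₂⟩ := exists_subset_card_eq (s := (univ : Finset X)) (n := s) (by omega)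
  obtain ⟨y₀, -⟩ := card_pos.mp (hYc ▸ hn)
  let T : Finset (X × Y) := X₁ ×ˢ {y₀} ∪ X₂ ×ˢ (univ.erase y₀)
  have hT : #T < Module.finrank F C := by
    refine (card_union_le _ _).trans_lt ?_
    rw [card_product, card_product, hX₁, hX₂, card_singleton, card_erase_of_mem (mem_univ _), hYc,
      hC, mul_comm s]
    omega
  obtain ⟨f, hf, hf0, hfT⟩ := exists_ne_zero_vanishing_on (T.map β.symm.toEmbedding)
    (by rwa [card_map])
  have hfT' : ∀ z ∈ T, f (β.symm z) = 0 := fun z hz => hfT _ (mem_map_of_mem _ hz)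
  refine ⟨f, hf, hf0, ?_⟩
  have hle : #{i | f i ≠ 0} ≤ #((univ \ X₁) ×ˢ {y₀}) := by
    refine card_le_card_of_injOn β (fun i hi => ?_) β.injective.injOn
    have hi : f i ≠ 0 := by simpa using hi
    have hy : (β i).2 = y₀ := by
      by_contra hne
      refine hi ?_
      have := hfib f hf (β i).2 X₂ hX₂.ge (fun x hx => hfT' _ (by simp [T, hx, hne])) (β i).1
      simpa using this
    have hx : (β i).1 ∉ X₁ := fun hx => hi (by
      have := hfT' (β i) (mem_union_left _ (mem_product.mpr ⟨hx, by simpa using hy⟩))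
      simpa using this)
    exact mem_coe.mpr (mem_product.mpr
      ⟨mem_sdiff.mpr ⟨mem_univ _, hx⟩, mem_singleton.mpr hy⟩)
  rw [card_product, card_singleton, card_sdiff_of_subset (subset_univ _), hXc, hX₁] at hle
  omega

end Fibers

section Code

variable {K : Type*} [Field K] {N M n' m m' s s' : ℕ} {X Y : Finset K} {E E' : Finset ℕ}

theorem exists_coeff_of_mem_span (β : Fin N ≃ X × Y) {D : Finset (ℕ × ℕ)} {v : Fin N → K}
    (hv : v ∈ Submodule.span K (evalMonomial β '' D)) :
    ∃ c : ℕ × ℕ → K, ∀ i, v i = ∑ e ∈ D, c e * (((β i).1 : K) ^ e.1 * ((β i).2 : K) ^ e.2) := by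
  obtain ⟨c, rfl⟩ := (Submodule.mem_span_image_finset_iff_exists_fun' K).mp hv
  exact ⟨c, fun i => by simp [evalMonomial]⟩

theorem frobenius_mem_span {F : Type*} [Field F] [Fintype F] [Algebra F K] (β : Fin N ≃ X × Y)
    {D : Set (ℕ × ℕ)} (hD : ∀ e ∈ D, ∃ e' ∈ D, ∀ x ∈ X, ∀ y ∈ Y,
      (x ^ e.1 * y ^ e.2) ^ Fintype.card F = x ^ e'.1 * y ^ e'.2) :
    ∀ v ∈ Submodule.span K (evalMonomial β '' D),
      (fun i => v i ^ Fintype.card F) ∈ Submodule.span K (evalMonomial β '' D) := by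
  intro v hv
  induction hv using Submodule.span_induction with
  | mem v hv =>
    obtain ⟨e, he, rfl⟩ := hv
    obtain ⟨e', he', h⟩ := hD e he
    refine Submodule.subset_span ⟨e', he', ?_⟩
    ext i
    exact (h _ (β i).1.2 _ (β i).2.2).symm
  | zero =>
    convert Submodule.zero_mem _ using 1
    ext i
    simp
  | add v w _ _ hv hw =>
    convert Submodule.add_mem _ hv hw using 1
    ext i
    exact map_add (FiniteField.frobeniusAlgHom F K) (v i) (w i)
  | smul a v _ hv =>
    convert Submodule.smul_mem _ (a ^ Fintype.card F) hv using 1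
    ext i
    simp [mul_pow]

open Classical in
theorem weight_ge (β : Fin N ≃ X × Y) (hM : 0 < M) (hX : ∀ x ∈ X, x ^ M = 1) (hXM : #X = M)
    (hY : #Y = n') (hEE : E' ⊆ E) (hE : ∀ e ∈ E, (e + m) % M < s)
    (hE' : ∀ e ∈ E', (e + m') % M < s') (hss : 2 * s ≤ M + 1 + s')
    {v : Fin N → K} (hv : v ∈ Submodule.span K (evalMonomial β '' (exponentSet E E' n')))
    (hv0 : v ≠ 0) : M + 1 ≤ #{i | v i ≠ 0} + s' := by
  obtain ⟨c, hc⟩ := exists_coeff_of_mem_span β hv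
  obtain ⟨i₀, hi₀⟩ := Function.ne_iff.mp hv0
  have hfib : ∀ i, v i ≠ 0 → M + 1 ≤ #{j | v j ≠ 0 ∧ (β j).2 = (β i).2} + s := fun i hi => by
    rw [← hXM]
    exact card_fiber_support β (w := fun x y => ∑ e ∈ exponentSet E E' n', c e * (x ^ e.1 * y ^ e.2))
      hc hi fun S hSX hS h x hx => sum_exponentSet_eq_zero_of_fiber hM hX hE c _ hSX hS h hx
  by_cases h1 : ∃ i₁, v i₁ ≠ 0 ∧ (β i₁).2 ≠ (β i₀).2
  · obtain ⟨i₁, hi₁, hne⟩ := h1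
    have h2 := hfib i₀ hi₀
    have h3 := hfib i₁ hi₁
    have h4 : #{j | v j ≠ 0 ∧ (β j).2 = (β i₀).2} + #{j | v j ≠ 0 ∧ (β j).2 = (β i₁).2} ≤
        #{i | v i ≠ 0} := by
      rw [← card_union_of_disjoint]
      · refine card_le_card fun i hi => ?_
        simp only [mem_union, mem_filter, mem_univ, true_and] at hi ⊢
        tauto
      · rw [disjoint_filter]
        rintro i - ⟨-, h⟩ ⟨-, h'⟩
        exact hne (h'.symm.trans h)
    omega
  · push Not at h1
    have h0 : ∀ x ∈ X, ∀ y ∈ Y, y ≠ (β i₀).2 →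
        ∑ e ∈ exponentSet E E' n', c e * (x ^ e.1 * y ^ e.2) = 0 := by
      intro x hx y hy hyy
      by_contra hne
      have := h1 (β.symm (⟨x, hx⟩, ⟨y, hy⟩)) (by rw [hc]; simpa using hne)
      rw [Equiv.apply_symm_apply] at this
      exact hyy (congrArg Subtype.val this)
    have h2 : #X + 1 ≤ #{j | v j ≠ 0 ∧ (β j).2 = (β i₀).2} + s' :=
      card_fiber_support β (w := fun x y => ∑ e ∈ exponentSet E E' n', c e * (x ^ e.1 * y ^ e.2))
        hc hi₀ fun S hSX hS h x hx =>
          sum_exponentSet_eq_zero_of_single_fiber hM hX hY hEE hE' c (β i₀).2.2 h0 hSX hS h hx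
    have h3 : #{j | v j ≠ 0 ∧ (β j).2 = (β i₀).2} ≤ #{i | v i ≠ 0} :=
      card_le_card fun i hi => by
        simp only [mem_filter, mem_univ, true_and] at hi ⊢
        exact hi.1
    omega

end Code

end LRC

namespace LRC

open Finset

theorem monomialCode_eq_span {K : Type*} [Field K] {N : ℕ} {X Y : Finset K} (β : Fin N ≃ X × Y)
    {α : Fin N → Fin 2 → K} (hα : ∀ i, α i = ![((β i).1 : K), ((β i).2 : K)]) (D : Set (ℕ × ℕ)) :
    monomialCode α ((fun e : ℕ × ℕ => ![e.1, e.2]) '' D) =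
      Submodule.span K (evalMonomial β '' D) := by
  rw [monomialCode, Set.image_image]
  congr 2
  ext e i
  simp [hα, evalMonomial, Fin.prod_univ_two]

theorem ceil_div_eq {n s s' : ℕ} (hs' : 0 < s') (hss : s' ≤ s) :
    ⌈((n * s + s' : ℕ) : ℚ) / (s : ℚ)⌉ = n + 1 := by
  have hs : (0 : ℚ) < s := by exact_mod_cast hs'.trans_le hss
  have h1 : (0 : ℚ) < s' := by exact_mod_cast hs'
  have h2 : (s' : ℚ) ≤ s := by exact_mod_cast hss
  rw [Int.ceil_eq_iff]
  push_cast
  constructor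
  · rw [lt_div_iff₀ hs]; linarith
  · rw [div_le_iff₀ hs]; linarith

theorem exists_optimal_code {K F : Type*} [Field K] [Fintype K] [Field F] [Fintype F] [Algebra F K]
    {M n' m m' s s' : ℕ} {X Y : Finset K} {E E' : Finset ℕ} {J : Finset (Fin 2)}
    (hM : 0 < M) (hn : 0 < n') (hX : ∀ x ∈ X, x ^ M = 1) (hXM : #X = M) (hY : #Y = n')
    (hXY : ∀ a : Fin 2 → K, a ∈ jAffinePoints K ![M, n'] J ↔ a 0 ∈ X ∧ a 1 ∈ Y)
    (hJ : ∀ j ∈ J, ![M, n'] j ∣ Fintype.card K - 1)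
    (hJ' : ∀ j ∉ J, ![M, n'] j - 1 ∣ Fintype.card K - 1)
    (hEM : E ⊆ range M) (hEE : E' ⊆ E) (hEs : #E = s) (hEs' : #E' = s')
    (hE : ∀ e ∈ E, (e + m) % M < s) (hE' : ∀ e ∈ E', (e + m') % M < s')
    (hs' : 0 < s') (hss : 2 * s ≤ M + 1 + s')
    (hfrobX : ∀ e < M, ∃ e' < M, (∀ x ∈ X, (x ^ e) ^ Fintype.card F = x ^ e') ∧
      (e ∈ E ↔ e' ∈ E) ∧ (e ∈ E' ↔ e' ∈ E'))
    (hfrobY : ∀ j < n', ∃ j' < n', (∀ y ∈ Y, (y ^ j) ^ Fintype.card F = y ^ j') ∧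
      (E' = E ∨ (j + 1 = n' ↔ j' + 1 = n'))) :
    ∃ C : Submodule F (Fin (M * n') → F),
      IsSubfieldSubcodeOfJAffine K ![M, n'] C ∧
      HasParameters C ((n' - 1) * s + s') (M + 1 - s') ∧ IsOptimalLRC C s (M + 1 - s) := by
  classical
  have hs's : s' ≤ s := hEs ▸ hEs' ▸ card_le_card hEE
  have hsM : s ≤ M := by simpa [hEs] using card_le_card hEM
  let β : Fin (M * n') ≃ X × Y := Fintype.equivOfCardEq (by simp [hXM, hY])
  let D := exponentSet E E' n'
  have hDsub : D ⊆ range M ×ˢ range n' := fun e he => by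
    have := mem_product.mp (mem_filter.mp he).1
    exact mem_product.mpr ⟨hEM this.1, this.2⟩
  have hDcard : #D = (n' - 1) * s + s' := by rw [card_exponentSet hEE hn, hEs, hEs']
  have hfrob : ∀ e ∈ range M ×ˢ range n', ∃ e' ∈ range M ×ˢ range n', (e ∈ D ↔ e' ∈ D) ∧
      ∀ x ∈ X, ∀ y ∈ Y, (x ^ e.1 * y ^ e.2) ^ Fintype.card F = x ^ e'.1 * y ^ e'.2 := by
    rintro ⟨e, j⟩ he
    rw [mem_product, mem_range, mem_range] at he
    obtain ⟨e', he', hx, h1, h2⟩ := hfrobX e he.1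
    obtain ⟨j', hj', hy, h3⟩ := hfrobY j he.2
    refine ⟨(e', j'), by simp [he', hj'], ?_, fun x hxX y hyY => ?_⟩
    · have hj : j < n' := he.2
      simp only [D, exponentSet, mem_filter, mem_product, mem_range, hj, hj', and_true, h1]
      rcases h3 with rfl | h3
      · tauto
      · rw [h2, h3]
    · rw [mul_pow, hx x hxX, hy y hyY]
  let V := Submodule.span K (evalMonomial β '' D)
  let C : Submodule F (Fin (M * n') → F) := subfieldSubcode F V
  have hrank : Module.finrank F C = (n' - 1) * s + s' := by
    rw [← hDcard, ← finrank_span_evalMonomial β hXM hY hDsub]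
    refine finrank_subfieldSubcode (isCompl_span_evalMonomial β hXM hY hDsub)
      (frobenius_mem_span β fun e he => ?_) (frobenius_mem_span β fun e he => ?_)
    · obtain ⟨e', -, h1, h2⟩ := hfrob e (hDsub he)
      exact ⟨e', h1.mp he, h2⟩
    · have he := mem_sdiff.mp (mem_coe.mp he)
      obtain ⟨e', h0, h1, h2⟩ := hfrob e he.1
      exact ⟨e', mem_coe.mpr (mem_sdiff.mpr ⟨h0, fun h => he.2 (h1.mpr h)⟩), h2⟩
  have hCV : ∀ f ∈ C, (fun i => algebraMap F K (f i)) ∈ V := fun f hf => hf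
  have hne : ∀ a : F, algebraMap F K a = 0 ↔ a = 0 := fun a => map_eq_zero _
  have hlow : ∀ f ∈ C, f ≠ 0 → M + 1 - s' ≤ #{i | f i ≠ 0} := fun f hf hf0 => by
    have := weight_ge β hM hX hXM hY hEE hE hE' hss (hCV f hf)
      (fun h => hf0 (funext fun i => (hne _).mp (congrFun h i)))
    simp only [ne_eq, hne] at this ⊢
    omega
  have hzero : ∀ f ∈ C, ∀ y : Y, ∀ S : Finset X, s ≤ #S → (∀ x ∈ S, f (β.symm (x, y)) = 0) →
      ∀ x, f (β.symm (x, y)) = 0 := by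
    intro f hf y S hS h x
    obtain ⟨c, hc⟩ := exists_coeff_of_mem_span β (hCV f hf)
    rw [← hne, hc]
    simp only [Equiv.apply_symm_apply]
    refine sum_exponentSet_eq_zero_of_fiber hM hX hE c y (S := S.map (Function.Embedding.subtype _))
      (fun a ha => ?_) (by rwa [card_map]) (fun a ha => ?_) x.2
    · obtain ⟨b, -, rfl⟩ := mem_map.mp ha
      exact b.2
    · obtain ⟨b, hb, rfl⟩ := mem_map.mp ha
      have := hc (β.symm (b, y))
      rw [h b hb, map_zero] at this
      simpa using this.symm
  have hparam : HasParameters C ((n' - 1) * s + s') (M + 1 - s') := by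
    refine ⟨hrank, le_antisymm ?_ (le_minDist hlow)⟩
    obtain ⟨f, hf, hf0, hw⟩ := exists_weight_le β hXM hY hn hzero hs' (by omega) hsM hrank
    refine (minDist_le hf hf0).trans (Nat.cast_le.mpr ?_)
    omega
  refine ⟨C, ?_, hparam, ?_, _, _, hparam, ?_⟩
  · let ε : X × Y ≃ jAffinePoints K ![M, n'] J :=
      { toFun := fun z => ⟨![z.1, z.2], (hXY _).mpr ⟨z.1.2, z.2.2⟩⟩
        invFun := fun a => (⟨a.1 0, ((hXY _).mp a.2).1⟩, ⟨a.1 1, ((hXY _).mp a.2).2⟩)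
        left_inv := fun z => rfl
        right_inv := fun a => by
          ext j
          fin_cases j <;> rfl }
    refine ⟨J, (fun e : ℕ × ℕ => ![e.1, e.2]) '' (D : Set (ℕ × ℕ)), β.trans ε, hJ, hJ', ?_, ?_, ?_⟩
    · have : 0 < #D := by omega
      exact (coe_nonempty.mpr (card_pos.mp this)).image _
    · rintro _ ⟨e, he, rfl⟩ j
      have := mem_product.mp (hDsub he)
      fin_cases j
      · exact mem_range.mp this.1
      · exact mem_range.mp this.2
    · exact congrArg (subfieldSubcode F) (monomialCode_eq_span β (fun i => rfl) D).symm
  · intro i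
    refine ⟨({j | (β j).2 = (β i).2} : Finset _), by simp, ?_, le_minDist ?_⟩
    · have : #{j | (β j).2 = (β i).2} ≤ #X := by
        rw [← Fintype.card_coe X, ← card_univ]
        refine card_le_card_of_injOn (fun j => (β j).1) (fun _ _ => mem_coe.mpr (mem_univ _))
          fun j hj j' hj' h => β.injective (Prod.ext h ?_)
        have hj : (β j).2 = (β i).2 := by simpa using hj
        have hj' : (β j').2 = (β i).2 := by simpa using hj'
        rw [hj, hj']
      omega
    · rintro _ ⟨f, hf, rfl⟩ hg
      obtain ⟨⟨j, hj⟩, hj0⟩ := Function.ne_iff.mp hg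
      have hji : (β j).2 = (β i).2 := by simpa using hj
      obtain ⟨c, hc⟩ := exists_coeff_of_mem_span β (hCV f hf)
      have h1 := card_fiber_support β (t := s) (i₀ := j)
        (w := fun x y => ∑ e ∈ D, c e * (x ^ e.1 * y ^ e.2)) hc ((hne _).not.mpr hj0)
        fun S hSX hS h x hx => sum_exponentSet_eq_zero_of_fiber hM hX hE c _ hSX hS h hx
      have h2 : #{k | algebraMap F K (f k) ≠ 0 ∧ (β k).2 = (β j).2} ≤
          #{k : ({j | (β j).2 = (β i).2} : Finset _) | f k ≠ 0} := by
        refine le_of_le_of_eq (card_le_card fun k hk => ?_) (card_map (Function.Embedding.subtype _))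
        simp only [mem_filter, mem_univ, true_and, ne_eq, hne] at hk
        exact mem_map.mpr ⟨⟨k, by simp [hk.2, hji]⟩, by simpa using hk.1, rfl⟩
      have h3 : M + 1 - s ≤ #{k : ({j | (β j).2 = (β i).2} : Finset _) | f k ≠ 0} := by omega
      exact h3
  · obtain ⟨n, rfl⟩ := Nat.exists_eq_succ_of_ne_zero hn.ne'
    rw [Nat.succ_eq_add_one, Nat.add_sub_cancel, ceil_div_eq hs' hs's]
    push_cast [Nat.cast_sub (show s' ≤ M + 1 by omega), Nat.cast_sub (show s ≤ M + 1 by omega)]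
    ring

end LRC

namespace LRC

open Finset

/-- The `s` cyclically consecutive residues `-m, …, -m + s - 1` modulo `M`. -/
def cyclicInterval (M m s : ℕ) : Finset ℕ :=
  (range M).filter fun e => (e + m) % M < s

theorem mem_cyclicInterval {M m s e : ℕ} : e ∈ cyclicInterval M m s ↔ e < M ∧ (e + m) % M < s := by
  rw [cyclicInterval, mem_filter, mem_range]

theorem mod_of_lt_two_mul {a M : ℕ} (h : a < 2 * M) : a % M = if a < M then a else a - M := by
  split_ifs with h1
  · exact Nat.mod_eq_of_lt h1
  · rw [Nat.mod_eq_sub_mod (by omega), Nat.mod_eq_of_lt (by omega)]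

theorem card_cyclicInterval {M m s : ℕ} (hm : m < M) (hs : s ≤ M) : #(cyclicInterval M m s) = s := by
  refine (card_nbij' (t := range s) (fun e => (e + m) % M) (fun b => (b + (M - m)) % M)
    ?_ ?_ ?_ ?_).trans (card_range s)
  · intro e he
    exact mem_coe.mpr (mem_range.mpr (mem_cyclicInterval.mp he).2)
  · intro b hb
    have hb := mem_range.mp hb
    rw [mem_coe, mem_cyclicInterval]
    dsimp only
    rw [mod_of_lt_two_mul (by omega : b + (M - m) < 2 * M)]
    split_ifs
    all_goals
      rw [mod_of_lt_two_mul (by omega)]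
      split_ifs <;> omega
  · intro e he
    have he := (mem_cyclicInterval.mp he).1
    dsimp only
    rw [mod_of_lt_two_mul (by omega : e + m < 2 * M)]
    split_ifs
    all_goals
      rw [mod_of_lt_two_mul (by omega)]
      split_ifs <;> omega
  · intro b hb
    have hb := mem_range.mp hb
    dsimp only
    rw [mod_of_lt_two_mul (by omega : b + (M - m) < 2 * M)]
    split_ifs
    all_goals
      rw [mod_of_lt_two_mul (by omega)]
      split_ifs <;> omega

theorem cyclicInterval_subset {M m d s : ℕ} (hm : m + d < M) (hs : s + 2 * d ≤ M) :
    cyclicInterval M m s ⊆ cyclicInterval M (m + d) (s + 2 * d) := by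
  intro e he
  rw [mem_cyclicInterval] at he ⊢
  rw [mod_of_lt_two_mul (by omega)] at he ⊢
  refine ⟨he.1, ?_⟩
  have := he.2
  split_ifs at this ⊢ <;> omega

theorem neg_mem_cyclicInterval {M m s e : ℕ} (hm : m < M) (hs : s ≤ M)
    (h : 2 * m + 1 = s ∨ 2 * m + 1 = s + M) (he : e < M) :
    e ∈ cyclicInterval M m s ↔ (M - e) % M ∈ cyclicInterval M m s := by
  rw [mem_cyclicInterval, mem_cyclicInterval, mod_of_lt_two_mul (by omega : e + m < 2 * M),
    mod_of_lt_two_mul (by omega : M - e < 2 * M)]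
  split_ifs
  all_goals
    rw [mod_of_lt_two_mul (by omega)]
    split_ifs <;> omega

section Roots

variable {K : Type*} [Field K] [Fintype K] [DecidableEq K] {n : ℕ}

theorem card_filter_pow_eq_one (hn : 0 < n) (h : n ∣ Fintype.card K - 1) :
    #{x : K | x ^ n = 1} = n := by
  obtain ⟨g, hg⟩ := IsCyclic.exists_ofOrder_eq_natCard (α := Kˣ)
  rw [Nat.card_eq_fintype_card, Fintype.card_units] at hg
  obtain ⟨k, hk⟩ := h
  have hpos : 0 < Fintype.card K - 1 := Nat.sub_pos_of_lt Fintype.one_lt_card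
  have hprim : IsPrimitiveRoot (g : K) (Fintype.card K - 1) :=
    IsPrimitiveRoot.coe_units_iff.mpr (hg ▸ IsPrimitiveRoot.orderOf g)
  have := (hprim.pow hpos (by rw [hk, mul_comm] : Fintype.card K - 1 = k * n)).card_nthRootsFinset
  refine Eq.trans (congrArg card ?_) this
  ext x
  simp [Polynomial.mem_nthRootsFinset hn]

theorem card_filter_pow_eq_self (hn : 0 < n) (h : n ∣ Fintype.card K - 1) :
    #{x : K | x ^ (n + 1) = x} = n + 1 := by
  have : ({x : K | x ^ (n + 1) = x} : Finset K) = insert 0 ({x : K | x ^ n = 1} : Finset K) := by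
    ext x
    by_cases hx : x = 0
    · simp [hx]
    · simp [hx, pow_succ]
  rw [this, card_insert_of_notMem (by simp [hn.ne']), card_filter_pow_eq_one hn h]

end Roots

section Frobenius

variable {K : Type*} [Field K]

theorem pow_pow_eq_of_pow_succ_eq_one {Q e : ℕ} {x : K} (hx : x ^ (Q + 1) = 1) (he : e < Q + 1) :
    (x ^ e) ^ Q = x ^ ((Q + 1 - e) % (Q + 1)) := by
  have hx0 : x ≠ 0 := by
    rintro rfl
    simp at hx
  rw [← pow_eq_pow_mod _ hx]
  refine mul_right_cancel₀ (pow_ne_zero e hx0) ?_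
  rw [← pow_succ, ← pow_mul, mul_comm, pow_mul, hx, one_pow, ← pow_add, Nat.sub_add_cancel he.le, hx]

theorem exists_exponent_of_pow_eq_self {Q n j : ℕ} (hQ : 0 < Q) (hn : 0 < n) (hQn : Q.Coprime n)
    (hj : j < n + 1) : ∃ j' < n + 1, (∀ y : K, y ^ (n + 1) = y → (y ^ j) ^ Q = y ^ j') ∧
      (j + 1 = n + 1 ↔ j' + 1 = n + 1) := by
  have hpow : ∀ y : K, y ^ (n + 1) = y → y ≠ 0 → y ^ n = 1 := fun y hy hy0 => by
    rw [pow_succ] at hy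
    exact (mul_eq_right₀ hy0).mp hy
  have hlt := Nat.mod_lt (j * Q) hn
  rcases Nat.eq_zero_or_pos j with rfl | hj0
  · exact ⟨0, by omega, by simp, by omega⟩
  have hne : j ≠ 0 := hj0.ne'
  by_cases hr : (j * Q) % n = 0
  · refine ⟨n, by omega, fun y hy => ?_, ?_⟩
    · by_cases hy0 : y = 0
      · simp [hy0, hn.ne', hne, hQ.ne']
      · rw [← pow_mul, pow_eq_pow_mod _ (hpow y hy hy0), hr, pow_zero, hpow y hy hy0]
    · have := Nat.le_of_dvd hj0 (hQn.symm.dvd_of_dvd_mul_right (Nat.dvd_of_mod_eq_zero hr))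
      omega
  · refine ⟨j * Q % n, by omega, fun y hy => ?_, ?_⟩
    · by_cases hy0 : y = 0
      · simp [hy0, hr, hne, hQ.ne']
      · rw [← pow_mul, pow_eq_pow_mod _ (hpow y hy hy0)]
    · have : j ≠ n := by
        rintro rfl
        simp at hr
      omega

theorem coprime_card_card_sub_one (F K : Type*) [Field F] [Field K] [Fintype F] [Fintype K]
    [Algebra F K] : (Fintype.card F).Coprime (Fintype.card K - 1) := by
  have h1 : Fintype.card F ∣ Fintype.card K := by
    rw [Module.card_eq_pow_finrank (K := F) (V := K)]
    exact dvd_pow_self _ Module.finrank_pos.ne'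
  refine Nat.Coprime.coprime_dvd_left h1 ?_
  have := Nat.coprime_self_sub_right (m := 1) (n := Fintype.card K) Fintype.card_pos
  simpa using this

end Frobenius

theorem exists_optimal_code_of_cyclicInterval {K F : Type*} [Field K] [Fintype K] [Field F]
    [Fintype F] [Algebra F K] {n' m d s : ℕ} (hn : 0 < n')
    (hdvd : Fintype.card F + 1 ∣ Fintype.card K - 1) (hs : 0 < s)
    (hm : m + d < Fintype.card F + 1) (hsd : s + 2 * d ≤ Fintype.card F + 1)
    (hsymm : 2 * m + 1 = s ∨ 2 * m + 1 = s + (Fintype.card F + 1))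
    (hdist : s + 4 * d ≤ Fintype.card F + 2)
    (hn' : (n' ∣ Fintype.card K - 1 ∧ d = 0) ∨ n' - 1 ∣ Fintype.card K - 1) :
    ∃ C : Submodule F (Fin ((Fintype.card F + 1) * n') → F),
      IsSubfieldSubcodeOfJAffine K ![Fintype.card F + 1, n'] C ∧
      HasParameters C ((n' - 1) * (s + 2 * d) + s) (Fintype.card F + 1 + 1 - s) ∧
      IsOptimalLRC C (s + 2 * d) (Fintype.card F + 1 + 1 - (s + 2 * d)) := by
  classical
  set Q := Fintype.card F with hQ
  have hQ0 : 0 < Q := Fintype.card_pos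
  have hK : 0 < Fintype.card K - 1 := Nat.sub_pos_of_lt Fintype.one_lt_card
  have hfrobX : ∀ e < Q + 1, ∃ e' < Q + 1,
      (∀ x ∈ ({x : K | x ^ (Q + 1) = 1} : Finset K), (x ^ e) ^ Q = x ^ e') ∧
      (e ∈ cyclicInterval (Q + 1) (m + d) (s + 2 * d) ↔
        e' ∈ cyclicInterval (Q + 1) (m + d) (s + 2 * d)) ∧
      (e ∈ cyclicInterval (Q + 1) m s ↔ e' ∈ cyclicInterval (Q + 1) m s) := fun e he =>
    ⟨(Q + 1 - e) % (Q + 1), Nat.mod_lt _ Q.succ_pos,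
      fun x hx => pow_pow_eq_of_pow_succ_eq_one (by simpa using hx) he,
      neg_mem_cyclicInterval hm hsd (by omega) he,
      neg_mem_cyclicInterval (by omega) (by omega) hsymm he⟩
  rcases hn' with ⟨hn', rfl⟩ | hn'
  · refine exists_optimal_code (X := {x : K | x ^ (Q + 1) = 1}) (Y := {y : K | y ^ n' = 1})
      (E := cyclicInterval (Q + 1) (m + 0) (s + 2 * 0)) (E' := cyclicInterval (Q + 1) m s)
      (m := m + 0) (m' := m) (J := univ)
      Q.succ_pos hn (fun x hx => by simpa using hx) (card_filter_pow_eq_one Q.succ_pos hdvd)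
      (card_filter_pow_eq_one hn hn') ?_ ?_ (fun j hj => absurd (mem_univ j) hj)
      (filter_subset _ _) (cyclicInterval_subset hm hsd) (card_cyclicInterval hm hsd)
      (card_cyclicInterval (by omega) (by omega)) (fun e he => (mem_cyclicInterval.mp he).2)
      (fun e he => (mem_cyclicInterval.mp he).2) hs (by omega) hfrobX ?_
    · intro a
      simp [jAffinePoints, Fin.forall_fin_two]
    · simp [Fin.forall_fin_two, hdvd, hn']
    · intro j _
      refine ⟨j * Q % n', Nat.mod_lt _ hn, fun y hy => ?_, .inl rfl⟩
      rw [← pow_mul, pow_eq_pow_mod _ (by simpa using hy : y ^ n' = 1)]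
  · obtain ⟨n, rfl⟩ := Nat.exists_eq_succ_of_ne_zero hn.ne'
    rw [Nat.succ_eq_add_one, Nat.add_sub_cancel] at *
    have hn0 : 0 < n := Nat.pos_of_dvd_of_pos hn' hK
    refine exists_optimal_code (X := {x : K | x ^ (Q + 1) = 1}) (Y := {y : K | y ^ (n + 1) = y})
      (E := cyclicInterval (Q + 1) (m + d) (s + 2 * d)) (E' := cyclicInterval (Q + 1) m s)
      (m := m + d) (m' := m) (J := {0})
      Q.succ_pos hn (fun x hx => by simpa using hx) (card_filter_pow_eq_one Q.succ_pos hdvd)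
      (card_filter_pow_eq_self hn0 hn') ?_ ?_ ?_
      (filter_subset _ _) (cyclicInterval_subset hm hsd) (card_cyclicInterval hm hsd)
      (card_cyclicInterval (by omega) (by omega)) (fun e he => (mem_cyclicInterval.mp he).2)
      (fun e he => (mem_cyclicInterval.mp he).2) hs (by omega) hfrobX ?_
    · intro a
      simp [jAffinePoints, Fin.forall_fin_two]
    · simp [hdvd]
    · simp [Fin.forall_fin_two, hn']
    · intro j hj
      obtain ⟨j', h1, h2, h3⟩ := exists_exponent_of_pow_eq_self (K := K) hQ0 hn0
        ((coprime_card_card_sub_one F K).coprime_dvd_right hn') hj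
      exact ⟨j', h1, fun y hy => h2 y (by simpa using hy), .inr h3⟩

end LRC

theorem mainTheorem1 (p l h q : ℕ) (hp : p.Prime) (hl : 0 < l) (hh : 0 < h) (hhl : h ∣ l)
    (hq : q = p ^ l) (hph : if p = 2 then 4 ≤ p ^ h else 5 ≤ p ^ h) (hdvd : p ^ h + 1 ∣ q - 1)
    (K F : Type*) [Field K] [Fintype K] [Field F] [Fintype F] [Algebra F K]
    (hK : Fintype.card K = q) (hF : Fintype.card F = p ^ h) :
    (∀ z t : ℕ, t < z → z ≤ p ^ h / 2 - 1 → max 0 (4 * (z : ℤ) - (p : ℤ) ^ h - 1) ≤ 2 * (t : ℤ) →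
      ∀ n' a : ℕ, 0 < n' →
        ((n' ∣ q - 1 ∧ a = z) ∨
          (n' - 1 ∣ q - 1 ∧ a = z) ∨
          (n' - 1 ∣ q - 1 ∧ a = t ∧
            (Odd p → Nat.gcd n' (p ^ h) ≠ 1 ∨ Nat.gcd n' (p ^ h + 1) ≠ 1))) →
        ∃ C : Submodule F (Fin ((p ^ h + 1) * n') → F),
          LRC.IsSubfieldSubcodeOfJAffine K ![p ^ h + 1, n'] C ∧
          LRC.HasParameters C ((n' - 1) * (2 * z + 1) + 2 * a + 1) (p ^ h + 1 - 2 * a) ∧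
          LRC.IsOptimalLRC C (2 * z + 1) (p ^ h - 2 * z + 1)) ∧
    (p = 2 → ∀ u : ℕ, u ≤ p ^ h / 2 - 2 →
      ∀ n' a : ℕ, 0 < n' →
        ((n' ∣ q - 1 ∧ a = u) ∨
          (n' - 1 ∣ q - 1 ∧ a = u) ∨
          (n' - 1 ∣ q - 1 ∧ ∃ v : ℕ, v < u ∧
            max 0 (4 * (u : ℤ) + 1 - (p : ℤ) ^ h) ≤ 2 * (v : ℤ) + 1 ∧ a = v)) →
        ∃ C : Submodule F (Fin ((p ^ h + 1) * n') → F),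
          LRC.IsSubfieldSubcodeOfJAffine K ![p ^ h + 1, n'] C ∧
          LRC.HasParameters C ((n' - 1) * (2 * u + 2) + 2 * a + 2) (p ^ h - 2 * a) ∧
          LRC.IsOptimalLRC C (2 * u + 2) (p ^ h - 2 * u)) := by
  subst hq
  have hpF : (p : ℤ) ^ h = (Fintype.card F : ℤ) := by rw [hF, Nat.cast_pow]
  rw [hpF]
  rw [← hF] at hph hdvd ⊢
  rw [← hK] at hdvd ⊢
  refine ⟨fun z t htz hz ht n' a hn' hcase => ?_, fun hp2 u hu n' a hn' hcase => ?_⟩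
  · have haz : a ≤ z ∧ 4 * z ≤ Fintype.card F + 1 + 2 * a := by omega
    obtain ⟨C, h1, h2, h3⟩ := LRC.exists_optimal_code_of_cyclicInterval (K := K) (F := F) (m := a)
      (d := z - a) (s := 2 * a + 1) hn' hdvd (by omega) (by omega) (by omega) (by omega)
      (by omega) (hcase.imp (fun h => ⟨h.1, by omega⟩) (fun h => h.elim And.left And.left))
    rw [show 2 * a + 1 + 2 * (z - a) = 2 * z + 1 by omega] at h2 h3
    refine ⟨C, h1, ?_, ?_⟩
    · convert h2 using 1 <;> omega
    · convert h3 using 1 <;> omega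
  · have hau : a ≤ u ∧ 4 * u ≤ Fintype.card F + 2 * a := by
      rcases hcase with h | h | ⟨-, v, h⟩ <;> omega
    obtain ⟨k, hk⟩ : 2 ∣ Fintype.card F := by
      rw [hF, hp2]
      exact dvd_pow_self 2 hh.ne'
    rw [if_pos hp2] at hph
    obtain ⟨C, h1, h2, h3⟩ := LRC.exists_optimal_code_of_cyclicInterval (K := K) (F := F)
      (m := k + 1 + a) (d := u - a) (s := 2 * a + 2) hn' hdvd (by omega) (by omega) (by omega)
      (by omega) (by omega)
      (hcase.imp (fun h => ⟨h.1, by omega⟩) (fun h => h.elim And.left And.left))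
    rw [show 2 * a + 2 + 2 * (u - a) = 2 * u + 2 by omega] at h2 h3
    refine ⟨C, h1, ?_, ?_⟩
    · convert h2 using 1 <;> omega
    · convert h3 using 1 <;> omega
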